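/- Let $2\le d<N$, let $x_1,\dots,x_N\in\mathbb R^d$, and put $R=\max_i\|x_i\|_2$, $X_D=\{x_i:i\in D\}$ for $D\subseteq[N]$, and $X=X_{[N]}$. Suppose that $\operatorname{conv}(X_D)$ has nonempty interior for every $D\subseteq[N]$ with $|D|>d$. The curvature of $x_i$ is $$\kappa(x_i)=\frac{|V_i|}{|\mathbb S^{d-1}|},\qquad V_i=\{v\in\mathbb S^{d-1}:\ v^Tx_i\ge v^Tx_j\ \text{for all } j\in[N]\},$$ where $|\cdot|$ is the surface measure of the unit sphere $\mathbb S^{d-1}$. Let $\kappa_1\ge\kappa_2\ge\dots\ge\kappa_N$ be the numbers $\kappa(x_1),\dots,\kappa(x_N)$ in decreasing order, and $\kappa_{N+1}=0$. For $\eta>0$ and $M\in\mathbb N$ consider the following algorithm. Draw $v_1,\dots,v_M$ independently and uniformly from $\mathbb S^{d-1}$. For each $i\in[M]$ choose $u_i\in\arg\max_{j\in[N]}v_i^Tx_j$, and let $e_j=|\{i\in[M]:u_i=j\}|$ for $j\in[N]$. List the indices as $\ell_1,\dots,\ell_N$ with $e_{\ell_1}\ge\dots\ge e_{\ell_N}$,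 put $$L=\max\Bigl\{\min\Bigl\{\ell:\ \tfrac1M\sum_{j=1}^{\ell}e_{\ell_j}>1-\tfrac{\eta}{3}\Bigr\},\ d+1\Bigr\},$$ and return $T=\{\ell_1,\dots,\ell_L\}$. Ties in the maximization and in the sorting are broken arbitrarily. Let $q$ be the smallest integer $j\ge1$ such that $\sum_{i=1}^{j}\kappa_i\ge1-\eta/18$, and suppose that $\Delta:=\kappa_q-\kappa_{q+1}>0$. Let $\delta>0$. If $$M\ge\max\Bigl\{\frac{324q^2}{\eta^2},\frac{4}{\Delta^2}\Bigr\}\log\Bigl(\frac{3N}{\sqrt\delta}\Bigr),$$ then with probability at least $1-\delta$, whatever the way in which ties are broken, $$|T|\le\max\{q,d+1\}\quad\text{and}\quad d_H\bigl(\operatorname{conv}(X_T),\operatorname{conv}(X)\bigr)\le\min\bigl\{\sqrt2\,\pi\,\eta^{1/(d-1)},2\bigr\}\cdot R,$$ where $d_H$ is the Hausdorff distance. -/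

import Mathlib

open MeasureTheory ProbabilityTheory

namespace ApproxHull

/-- The uniform probability measure on the unit sphere of `ℝ^d`: normalized surface measure. -/
noncomputable def uniformSphere (d : ℕ) :
    Measure (Metric.sphere (0 : EuclideanSpace ℝ (Fin d)) 1) :=
  ((volume : Measure (EuclideanSpace ℝ (Fin d))).toSphere Set.univ)⁻¹ •
    (volume : Measure (EuclideanSpace ℝ (Fin d))).toSphere

/-- The unit directions `v` in which `x i` is a maximizer of `⟨v, x j⟩` over all data points. -/
def normalDirections {d N : ℕ} (x : Fin N → EuclideanSpace ℝ (Fin d)) (i : Fin N) :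
    Set (Metric.sphere (0 : EuclideanSpace ℝ (Fin d)) 1) :=
  {v | ∀ j, inner ℝ (v : EuclideanSpace ℝ (Fin d)) (x j) ≤
    inner ℝ (v : EuclideanSpace ℝ (Fin d)) (x i)}

/-- The curvature of the data point `x i`: the fraction of the unit sphere covered by its
normal directions. (If the data points are distinct and `x i` is not an extreme point of the hull,
then it is `0`.) -/
noncomputable def curvature {d N : ℕ} (x : Fin N → EuclideanSpace ℝ (Fin d)) (i : Fin N) : ℝ :=
  (uniformSphere d).real (normalDirections x i)

/-- The curvatures in decreasing order, `sortedCurvature x 0 ≥ sortedCurvature x 1 ≥ ⋯`,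
so that the `k`-th largest one is `sortedCurvature x (k - 1)`; continued by `0` after the `N`-th. -/
noncomputable def sortedCurvature {d N : ℕ} (x : Fin N → EuclideanSpace ℝ (Fin d)) (k : ℕ) : ℝ :=
  if h : k < N then
    curvature x (Tuple.sort (fun i => -curvature x i) ⟨k, h⟩)
  else 0

/-- The counter `e_j` at the end of the loop: how often the index `j` was selected. -/
def hitCount {N M : ℕ} (u : Fin M → Fin N) (j : Fin N) : ℕ :=
  (Finset.univ.filter fun i => u i = j).card

/-- The number `L` of points that are kept, given an enumeration `σ` of the indices by decreasing
counters: the least `ℓ` such that the first `ℓ` estimated curvatures `e_j / M` sum to more than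
`1 - η / 3`, or `d + 1` if that is larger. -/
noncomputable def cutoff {N M : ℕ} (d : ℕ) (η : ℝ) (u : Fin M → Fin N)
    (σ : Equiv.Perm (Fin N)) : ℕ :=
  max (sInf {ℓ : ℕ | 1 - η / 3 <
    (1 / (M : ℝ)) * ∑ j ∈ Finset.univ.filter (fun j : Fin N => (j : ℕ) < ℓ),
      (hitCount u (σ j) : ℝ)}) (d + 1)

/-- `T` is a possible result of the algorithm on the data `x` with accuracy `η` when the sampled
directions are `v 0, …, v (M - 1)`: `u i` is an index of a maximizer of `⟨v i, x j⟩`, `σ` lists the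
indices by decreasing counters, and `T` consists of the first `L` of them.
Ties in the maximization and in the sorting may be broken in any way. -/
def IsOutput {d N M : ℕ} (x : Fin N → EuclideanSpace ℝ (Fin d)) (η : ℝ)
    (v : Fin M → Metric.sphere (0 : EuclideanSpace ℝ (Fin d)) 1) (T : Finset (Fin N)) : Prop :=
  ∃ (u : Fin M → Fin N) (σ : Equiv.Perm (Fin N)),
    (∀ i, v i ∈ normalDirections x (u i)) ∧
    Antitone (fun j => hitCount u (σ j)) ∧
    T = (Finset.univ.filter fun j : Fin N => (j : ℕ) < cutoff d η u σ).map σ.toEmbedding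

end ApproxHull

/-! Geometry: let `y` in the full hull be at distance `r > 0` from `conv(X_T)`, with nearest point
`z`, and let `w = (y - z) / r`. Some `x i` exceeds every `x k`, `k ∈ T`, by at least `r` in
direction `w`. As `‖x i - x k‖ ≤ 2R`, these differences make an angle of at most `arccos s` with
`w`, where `s = r / (2R)`. Hence every `v` in the open cap of angular radius `arcsin s` about `w`
prefers `x i` to all of `X_T`, and the normal directions of `T` miss that cap. The cap has measure
at least `7/18 * (√2 s / π) ^ (d - 1)` (`cap_le_uniformSphere`), so a curvature deficit of `T` below
`7/18 * η` forces the distance bound (`hausdorffDist_convexHull_le`).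

Sampling: ties have probability zero, so `e_j / M` is an empirical frequency with mean `curvature x
j`. Hoeffding and a union bound bring all of them within `η / (18 q)` of their means, so sums over
at most `q` indices err by at most `η / 18`. This bounds the cutoff and leaves a deficit below `η /
3 + η / 18 = 7/18 * η` (`cutoff_le_and_sum_curvature`). -/

namespace ApproxHull

open scoped Pointwise

/-! ### Flattened balls -/

/-- The linear map that fixes the unit vector `w` and scales its orthogonal complement by `c`. -/
noncomputable def axialScaling {d : ℕ} (w : EuclideanSpace ℝ (Fin d)) (c : ℝ) :
    EuclideanSpace ℝ (Fin d) →ₗ[ℝ] EuclideanSpace ℝ (Fin d) :=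
  c • LinearMap.transvection (((1 - c) / c) • (innerSL ℝ w).toLinearMap) w

lemma axialScaling_apply {d : ℕ} (w : EuclideanSpace ℝ (Fin d)) {c : ℝ} (hc : c ≠ 0)
    (z : EuclideanSpace ℝ (Fin d)) :
    axialScaling w c z = c • z + ((1 - c) * inner ℝ w z) • w := by
  simp only [axialScaling, LinearMap.smul_apply, LinearMap.transvection.apply, smul_add, smul_smul]
  congr 2
  simp
  field_simp

/-- A transvection has determinant one plus the value of its functional at its vector, here `1 + (1
- c) / c = 1 / c`; the scalar `c` contributes `c ^ d`. -/
lemma det_axialScaling {d : ℕ} (hd : 1 ≤ d) {w : EuclideanSpace ℝ (Fin d)} (hw : ‖w‖ = 1) {c : ℝ}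
    (hc : c ≠ 0) : LinearMap.det (axialScaling w c) = c ^ (d - 1) := by
  obtain ⟨n, rfl⟩ := Nat.exists_eq_add_of_le' hd
  rw [axialScaling, LinearMap.det_smul, LinearMap.transvection.det]
  simp [hw]
  field_simp
  ring

lemma inner_axialScaling {d : ℕ} (w : EuclideanSpace ℝ (Fin d)) {c : ℝ} (hc : c ≠ 0)
    (y z : EuclideanSpace ℝ (Fin d)) :
    inner ℝ (axialScaling w c y) z = inner ℝ y (axialScaling w c z) := by
  simp only [axialScaling_apply w hc, inner_add_left, inner_add_right, real_inner_smul_left,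
    real_inner_smul_right, real_inner_comm w y]
  ring

lemma inner_axis_axialScaling {d : ℕ} {w : EuclideanSpace ℝ (Fin d)} (hw : ‖w‖ = 1) {c : ℝ}
    (hc : c ≠ 0) (z : EuclideanSpace ℝ (Fin d)) :
    inner ℝ w (axialScaling w c z) = inner ℝ w z := by
  simp only [axialScaling_apply w hc, inner_add_right, real_inner_smul_right,
    real_inner_self_eq_norm_sq, hw]
  ring

lemma norm_sq_axialScaling {d : ℕ} {w : EuclideanSpace ℝ (Fin d)} (hw : ‖w‖ = 1) {c : ℝ}
    (hc : c ≠ 0) (z : EuclideanSpace ℝ (Fin d)) :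
    ‖axialScaling w c z‖ ^ 2 = c ^ 2 * ‖z‖ ^ 2 + (1 - c ^ 2) * inner ℝ w z ^ 2 := by
  rw [← real_inner_self_eq_norm_sq, ← real_inner_self_eq_norm_sq]
  simp only [axialScaling_apply w hc, inner_add_right, inner_add_left, real_inner_smul_right,
    real_inner_smul_left, real_inner_comm w z]
  rw [real_inner_self_eq_norm_sq w, hw]
  ring

lemma norm_axialScaling_le {d : ℕ} {w : EuclideanSpace ℝ (Fin d)} (hw : ‖w‖ = 1) {c : ℝ}
    (hc : 0 < c) (hc1 : c ≤ 1) (z : EuclideanSpace ℝ (Fin d)) :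
    ‖axialScaling w c z‖ ≤ ‖z‖ := by
  have h := abs_real_inner_le_norm w z
  rw [hw, one_mul] at h
  have h2 : inner ℝ w z ^ 2 ≤ ‖z‖ ^ 2 := sq_le_sq.2 (by rwa [abs_of_nonneg (norm_nonneg z)])
  refine le_of_sq_le_sq ?_ (norm_nonneg z)
  rw [norm_sq_axialScaling hw hc.ne']
  nlinarith [mul_nonneg (show 0 ≤ 1 - c ^ 2 by nlinarith) (sub_nonneg.2 h2)]

/-- An ellipsoid obtained by flattening a ball centred on the axis `w` pairs positively with every
vector that makes a small enough angle with `w`. -/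
lemma inner_axialScaling_pos {d : ℕ} {w : EuclideanSpace ℝ (Fin d)} (hw : ‖w‖ = 1) {c ρ s : ℝ}
    (hc : 0 < c) (hρ : 0 < ρ) (hρ1 : ρ < 1) (hs : 0 < s)
    (hcond : ρ ^ 2 * (s ^ 2 + c ^ 2 * (1 - s ^ 2)) ≤ (1 - ρ) ^ 2 * s ^ 2)
    {p z : EuclideanSpace ℝ (Fin d)} (hp : p ∈ Metric.ball ((1 - ρ) • w) ρ)
    (hz : s * ‖z‖ ≤ inner ℝ w z) (hz0 : 0 < inner ℝ w z) :
    0 < inner ℝ (axialScaling w c p) z := by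
  rw [inner_axialScaling w hc.ne']
  set y := axialScaling w c z with hy
  have hwy : inner ℝ w y = inner ℝ w z := inner_axis_axialScaling hw hc.ne' z
  have hy0 : 0 < ‖y‖ := by
    rw [norm_pos_iff]
    rintro h
    rw [h, inner_zero_right] at hwy
    exact hz0.ne hwy
  -- The open ball of radius `ρ` about `(1 - ρ) • w` pairs positively with `y ≠ 0` once this holds.
  -- Squared, at the largest admissible `‖z‖ = ⟨w, z⟩ / s`, it is `hcond`.
  have hle : ρ * ‖y‖ ≤ (1 - ρ) * inner ℝ w z := by
    refine le_of_sq_le_sq ?_ (mul_nonneg (by linarith) hz0.le)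
    have h1 : s ^ 2 * ‖z‖ ^ 2 ≤ inner ℝ w z ^ 2 := by
      rw [← mul_pow]
      exact pow_le_pow_left₀ (by positivity) hz 2
    rw [mul_pow, mul_pow, norm_sq_axialScaling hw hc.ne']
    refine le_of_mul_le_mul_left ?_ (pow_pos hs 2)
    have h2 := mul_le_mul_of_nonneg_left h1 (by positivity : 0 ≤ ρ ^ 2 * c ^ 2)
    have h3 := mul_le_mul_of_nonneg_right hcond (sq_nonneg (inner ℝ w z))
    nlinarith
  have hsplit : inner ℝ p y = inner ℝ (p - (1 - ρ) • w) y + (1 - ρ) * inner ℝ w z := by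
    rw [inner_sub_left, real_inner_smul_left, hwy]
    ring
  have h4 := (abs_le.1 (abs_real_inner_le_norm (p - (1 - ρ) • w) y)).1
  have h5 : ‖p - (1 - ρ) • w‖ * ‖y‖ < ρ * ‖y‖ :=
    mul_lt_mul_of_pos_right (mem_ball_iff_norm.1 hp) hy0
  linarith

/-! ### Measure of cones and caps -/

lemma finrank_space (d : ℕ) : Module.finrank ℝ (EuclideanSpace ℝ (Fin d)) = d := by simp

lemma nontrivial_space {d : ℕ} (hd : 1 ≤ d) : Nontrivial (EuclideanSpace ℝ (Fin d)) := by
  have : Nonempty (Fin d) := ⟨⟨0, hd⟩⟩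
  infer_instance

lemma isProbabilityMeasure_uniformSphere {d : ℕ} (hd : 1 ≤ d) :
    IsProbabilityMeasure (uniformSphere d) := by
  have := nontrivial_space hd
  refine ⟨?_⟩
  rw [uniformSphere, Measure.smul_apply, smul_eq_mul]
  refine ENNReal.inv_mul_cancel ?_ (measure_ne_top _ _)
  rw [Ne, Measure.measure_univ_eq_zero]
  exact Measure.toSphere_ne_zero _

/-- The uniform measure of a set of directions is the relative volume of the cone over it. -/
lemma uniformSphere_apply {d : ℕ} (hd : 1 ≤ d)
    {S : Set (Metric.sphere (0 : EuclideanSpace ℝ (Fin d)) 1)} (hS : MeasurableSet S) :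
    uniformSphere d S * volume (Metric.ball (0 : EuclideanSpace ℝ (Fin d)) 1) =
      volume (Set.Ioo (0 : ℝ) 1 • ((↑) '' S : Set (EuclideanSpace ℝ (Fin d)))) := by
  have hd0 : (d : ENNReal) ≠ 0 := by simpa using (by omega : d ≠ 0)
  have hb0 : volume (Metric.ball (0 : EuclideanSpace ℝ (Fin d)) 1) ≠ 0 :=
    (Metric.measure_ball_pos _ _ one_pos).ne'
  have hbt : volume (Metric.ball (0 : EuclideanSpace ℝ (Fin d)) 1) ≠ ⊤ := measure_ball_lt_top.ne
  rw [uniformSphere, Measure.smul_apply, smul_eq_mul, Measure.toSphere_apply' _ hS,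
    Measure.toSphere_apply_univ, finrank_space, ENNReal.mul_inv (Or.inl hd0) (Or.inl (by simp))]
  calc _ = ((d : ENNReal)⁻¹ * d) *
        ((volume (Metric.ball (0 : EuclideanSpace ℝ (Fin d)) 1))⁻¹ *
          volume (Metric.ball (0 : EuclideanSpace ℝ (Fin d)) 1)) *
        volume (Set.Ioo (0 : ℝ) 1 • ((↑) '' S : Set (EuclideanSpace ℝ (Fin d)))) := by ring
    _ = _ := by rw [ENNReal.inv_mul_cancel hd0 (by simp), ENNReal.inv_mul_cancel hb0 hbt]; simp

/-- A lower bound for the measure of the directions that pair positively with all vectors making a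
small angle with `w`. -/
lemma le_uniformSphere_of_inner_pos {d : ℕ} (hd : 1 ≤ d) {w : EuclideanSpace ℝ (Fin d)}
    (hw : ‖w‖ = 1) {c ρ s : ℝ} (hc : 0 < c) (hc1 : c ≤ 1) (hρ : 0 < ρ) (hρ1 : ρ < 1) (hs : 0 < s)
    (hs1 : s ≤ 1) (hcond : ρ ^ 2 * (s ^ 2 + c ^ 2 * (1 - s ^ 2)) ≤ (1 - ρ) ^ 2 * s ^ 2)
    {S : Set (Metric.sphere (0 : EuclideanSpace ℝ (Fin d)) 1)} (hS : MeasurableSet S)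
    (hmem : ∀ v : Metric.sphere (0 : EuclideanSpace ℝ (Fin d)) 1,
      (∀ z, s * ‖z‖ ≤ inner ℝ w z → 0 < inner ℝ w z →
        0 < inner ℝ (v : EuclideanSpace ℝ (Fin d)) z) → v ∈ S) :
    c ^ (d - 1) * ρ ^ d ≤ (uniformSphere d).real S := by
  have := nontrivial_space hd
  have := isProbabilityMeasure_uniformSphere hd
  have hb0 : volume (Metric.ball (0 : EuclideanSpace ℝ (Fin d)) 1) ≠ 0 :=
    (Metric.measure_ball_pos _ _ one_pos).ne'
  have hbt : volume (Metric.ball (0 : EuclideanSpace ℝ (Fin d)) 1) ≠ ⊤ := measure_ball_lt_top.ne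
  -- The ball lies in the unit ball and flattening does not increase norms, so the ellipsoid stays
  -- in the truncated cone over `S`; its relative volume is `c ^ (d - 1) * ρ ^ d`.
  have hsub : axialScaling w c '' Metric.ball ((1 - ρ) • w) ρ ⊆
      Set.Ioo (0 : ℝ) 1 • ((↑) '' S : Set (EuclideanSpace ℝ (Fin d))) := by
    rintro _ ⟨p, hp, rfl⟩
    have hpos : ∀ z, s * ‖z‖ ≤ inner ℝ w z → 0 < inner ℝ w z →
        0 < inner ℝ (axialScaling w c p) z := fun z =>
      inner_axialScaling_pos hw hc hρ hρ1 hs hcond hp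
    have hne : 0 < ‖axialScaling w c p‖ := by
      rw [norm_pos_iff]
      intro h
      have hww : inner ℝ w w = (1 : ℝ) := by rw [real_inner_self_eq_norm_sq, hw]; norm_num
      have := hpos w (by rw [hw, hww]; linarith) (by rw [hww]; norm_num)
      rw [h, inner_zero_left] at this
      exact this.false
    have hlt : ‖axialScaling w c p‖ < 1 := by
      refine (norm_axialScaling_le hw hc hc1 p).trans_lt ?_
      have h1 := mem_ball_iff_norm.1 hp
      have h2 : ‖(1 - ρ) • w‖ = 1 - ρ := by
        rw [norm_smul, hw, Real.norm_of_nonneg (by linarith), mul_one]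
      have h3 := norm_add_le (p - (1 - ρ) • w) ((1 - ρ) • w)
      rw [sub_add_cancel] at h3
      linarith
    refine Set.mem_smul.2 ⟨_, ⟨hne, hlt⟩, ‖axialScaling w c p‖⁻¹ • axialScaling w c p,
      ⟨⟨‖axialScaling w c p‖⁻¹ • axialScaling w c p, ?_⟩, hmem _ ?_, rfl⟩, ?_⟩
    · rw [mem_sphere_zero_iff_norm, norm_smul, norm_inv, norm_norm, inv_mul_cancel₀ hne.ne']
    · intro z hz hz0
      rw [real_inner_smul_left]
      exact mul_pos (inv_pos.2 hne) (hpos z hz hz0)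
    · rw [smul_smul, mul_inv_cancel₀ hne.ne', one_smul]
  have hvol := measure_mono (μ := volume) hsub
  rw [← uniformSphere_apply hd hS, Measure.addHaar_image_linearMap, det_axialScaling hd hw hc.ne',
    Measure.addHaar_ball _ _ hρ.le, finrank_space, ← mul_assoc,
    ENNReal.mul_le_mul_iff_left hb0 hbt, ← ENNReal.ofReal_mul (abs_nonneg _),
    abs_of_nonneg (by positivity)] at hvol
  exact (ENNReal.ofReal_le_iff_le_toReal (measure_ne_top _ _)).1 hvol

/-- One inscribed ellipsoid does not suffice for all `s`: a narrow cap needs a ball flattened in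
proportion to `s`, a wide one is served by a round ball. Since `d ≥ 2`, one factor of the power can
be split off to absorb the constant `7/18`. -/
lemma cap_le_uniformSphere {d : ℕ} (hd : 2 ≤ d) {w : EuclideanSpace ℝ (Fin d)}
    (hw : ‖w‖ = 1) {s : ℝ} (hs : 0 < s) (hs1 : s ≤ 1)
    {S : Set (Metric.sphere (0 : EuclideanSpace ℝ (Fin d)) 1)} (hS : MeasurableSet S)
    (hmem : ∀ v : Metric.sphere (0 : EuclideanSpace ℝ (Fin d)) 1,
      (∀ z, s * ‖z‖ ≤ inner ℝ w z → 0 < inner ℝ w z →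
        0 < inner ℝ (v : EuclideanSpace ℝ (Fin d)) z) → v ∈ S) :
    7 / 18 * (√2 * s / Real.pi) ^ (d - 1) ≤ (uniformSphere d).real S := by
  obtain ⟨n, rfl⟩ := Nat.exists_eq_add_of_le' hd
  have hpi := Real.pi_gt_three
  have h2 : √2 ≤ 1.415 := by rw [Real.sqrt_le_left (by norm_num)]; norm_num
  have h3 : (1.732 : ℝ) ≤ √3 := Real.le_sqrt_of_sq_le (by norm_num)
  have h3' : √3 ^ 2 = 3 := Real.sq_sqrt (by norm_num)
  -- `1.415 / 3 < 0.472`.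
  have hq : √2 * s / Real.pi ≤ 0.472 * s := by
    rw [div_le_iff₀ (by linarith)]
    nlinarith [mul_le_mul_of_nonneg_right h2 hs.le]
  have hq0 : 0 ≤ √2 * s / Real.pi := by positivity
  have key : 7 / 18 * (√2 * s / Real.pi) ^ (n + 2 - 1) ≤
      7 / 18 * (0.472 * s) * (0.472 * s) ^ n := by
    rw [show n + 2 - 1 = n + 1 by omega, mul_assoc, ← pow_succ']
    gcongr
  refine key.trans ?_
  rcases le_total s (1 / 2) with h | h
  -- With `ρ = 1/3`, `hcond` reads `c² (1 - s²) ≤ 3 s²`, which `c = √3 s` satisfies; `s ≤ 1/2` gives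
  -- `c ≤ 1`.
  · refine le_trans ?_ (le_uniformSphere_of_inner_pos (by omega) hw (c := √3 * s) (ρ := 1 / 3)
      (by positivity) ?_ (by norm_num) (by norm_num) hs hs1 ?_ hS hmem)
    · have : (√3 * s) ^ (n + 2 - 1) * (1 / 3 : ℝ) ^ (n + 2) =
          1 / 3 * (√3 / 3 * s) * (√3 / 3 * s) ^ n := by
        rw [show n + 2 - 1 = n + 1 by omega, mul_assoc, ← pow_succ', pow_succ (1 / 3 : ℝ),
          ← mul_assoc, ← mul_pow, mul_comm]
        ring_nf
      rw [this]
      gcongr ?_ * (?_ * s) ^ n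
      · nlinarith
      · linarith
    · nlinarith [Real.sqrt_nonneg 3]
    · rw [mul_pow, h3']
      nlinarith [sq_nonneg s, sq_nonneg (s ^ 2)]
  · have h1s : 0 < 1 + s := by linarith
    -- With `c = 1`, equality in `hcond` means `ρ = (1 - ρ) s`: the ball is tangent to the cone over
    -- the cap.
    refine le_trans ?_ (le_uniformSphere_of_inner_pos (by omega) hw (c := 1) (ρ := s / (1 + s))
      one_pos le_rfl (by positivity) ?_ hs hs1 ?_ hS hmem)
    · rw [one_pow, one_mul, pow_add, mul_comm]
      have hle : 0.472 * s ≤ s / (1 + s) := by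
        rw [le_div_iff₀ h1s]
        nlinarith
      gcongr ?_ ^ n * ?_
      rw [div_pow, le_div_iff₀ (by positivity)]
      nlinarith [mul_nonneg hs.le (sub_nonneg.2 h), mul_nonneg hs.le (sub_nonneg.2 hs1),
        mul_nonneg (mul_nonneg hs.le (sub_nonneg.2 h)) (sub_nonneg.2 hs1)]
    · rw [div_lt_one h1s]; linarith
    · have : 1 - s / (1 + s) = 1 / (1 + s) := by field_simp; ring
      rw [this, div_pow, div_pow]
      apply le_of_eq
      ring

/-! ### Normal directions and their null overlaps -/

lemma measurableSet_normalDirections {d N : ℕ} (x : Fin N → EuclideanSpace ℝ (Fin d)) (i : Fin N) :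
    MeasurableSet (normalDirections x i) := by
  have : normalDirections x i = ⋂ j, {v : Metric.sphere (0 : EuclideanSpace ℝ (Fin d)) 1 |
      inner ℝ (v : EuclideanSpace ℝ (Fin d)) (x j) ≤
        inner ℝ (v : EuclideanSpace ℝ (Fin d)) (x i)} := by
    ext v
    simp [normalDirections]
  rw [this]
  exact (isClosed_iInter fun j => isClosed_le (by fun_prop) (by fun_prop)).measurableSet

/-- The cone over these directions lies in a hyperplane, which has volume zero. -/
lemma uniformSphere_orthogonal_eq_zero {d : ℕ} (hd : 1 ≤ d) {z : EuclideanSpace ℝ (Fin d)}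
    (hz : z ≠ 0) :
    uniformSphere d {v | inner ℝ (v : EuclideanSpace ℝ (Fin d)) z = 0} = 0 := by
  have hmeas : MeasurableSet {v : Metric.sphere (0 : EuclideanSpace ℝ (Fin d)) 1 |
      inner ℝ (v : EuclideanSpace ℝ (Fin d)) z = 0} :=
    (isClosed_eq (by fun_prop) (by fun_prop)).measurableSet
  have h := uniformSphere_apply hd hmeas
  have h0 : volume (Set.Ioo (0 : ℝ) 1 • ((↑) '' {v : Metric.sphere
      (0 : EuclideanSpace ℝ (Fin d)) 1 | inner ℝ (v : EuclideanSpace ℝ (Fin d)) z = 0} :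
      Set (EuclideanSpace ℝ (Fin d)))) = 0 := by
    refine measure_mono_null ?_ (Measure.addHaar_submodule volume (Submodule.span ℝ {z})ᗮ ?_)
    · rintro _ ⟨r, -, _, ⟨v, hv, rfl⟩, rfl⟩
      have hv' : inner ℝ (v : EuclideanSpace ℝ (Fin d)) z = 0 := hv
      rw [SetLike.mem_coe, Submodule.mem_orthogonal_singleton_iff_inner_left]
      simp [real_inner_smul_left, hv']
    · intro htop
      have : z ∈ (Submodule.span ℝ {z})ᗮ := htop ▸ Submodule.mem_top
      rw [Submodule.mem_orthogonal_singleton_iff_inner_left] at this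
      exact hz (inner_self_eq_zero.1 this)
  rw [h0] at h
  exact (mul_eq_zero.1 h).resolve_right (Metric.measure_ball_pos _ _ one_pos).ne'

lemma uniformSphere_inter_normalDirections {d N : ℕ} (hd : 1 ≤ d)
    {x : Fin N → EuclideanSpace ℝ (Fin d)} (hx : Function.Injective x) {i j : Fin N}
    (hij : i ≠ j) : uniformSphere d (normalDirections x i ∩ normalDirections x j) = 0 := by
  refine measure_mono_null ?_
    (uniformSphere_orthogonal_eq_zero hd (sub_ne_zero.2 (hx.ne hij)))
  rintro v ⟨hi, hj⟩
  rw [Set.mem_ofPred_eq, inner_sub_right, sub_eq_zero]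
  exact le_antisymm (hj i) (hi j)

/-- Distinctness follows because the hull of at most `d` points has empty interior. -/
lemma injective_of_interior_convexHull_nonempty {d N : ℕ} (hN : d < N) (hd : 1 ≤ d)
    {x : Fin N → EuclideanSpace ℝ (Fin d)}
    (hx : ∀ D : Finset (Fin N), d < D.card →
      (interior (convexHull ℝ (x '' (D : Set (Fin N))))).Nonempty) :
    Function.Injective x := by
  intro i j hxij
  by_contra hij
  obtain ⟨D, hD, -, hcard⟩ := Finset.exists_subsuperset_card_eq
    (Finset.subset_univ ({i, j} : Finset (Fin N))) (n := d + 1)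
    (by rw [Finset.card_pair hij]; omega) (by simp; omega)
  have himg : x '' (D : Set (Fin N)) = ((D.erase j).image x : Finset _) := by
    ext y
    simp only [Set.mem_image, Finset.mem_coe, Finset.mem_image, Finset.mem_erase]
    constructor
    · rintro ⟨k, hk, rfl⟩
      by_cases hkj : k = j
      · exact ⟨i, ⟨hij, hD (by simp)⟩, by rw [hxij, hkj]⟩
      · exact ⟨k, ⟨hkj, hk⟩, rfl⟩
    · rintro ⟨k, ⟨-, hk⟩, rfl⟩
      exact ⟨k, hk, rfl⟩
  have hint := hx D (by omega)
  rw [himg] at hint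
  have hspan := (interior_convexHull_nonempty_iff_affineSpan_eq_top).1 hint
  have hvec : vectorSpan ℝ (((D.erase j).image x : Finset _) :
      Set (EuclideanSpace ℝ (Fin d))) = ⊤ := by
    rw [← direction_affineSpan, hspan, AffineSubspace.direction_top]
  have hce : (D.erase j).card = (d - 1) + 1 := by
    rw [Finset.card_erase_of_mem (hD (by simp))]
    omega
  have hrank := finrank_vectorSpan_image_finset_le ℝ x (D.erase j) hce
  rw [hvec, finrank_top, finrank_space] at hrank
  omega

/-! ### From curvature deficit to Hausdorff distance -/

/-- If the normal directions of `T` cover all but a small part of the sphere, every point of the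
hull of all data points is close to the hull of those in `T`. -/
lemma hausdorffDist_convexHull_le {d N : ℕ} (hd : 2 ≤ d)
    {x : Fin N → EuclideanSpace ℝ (Fin d)} (hx : Function.Injective x) {η : ℝ} (hη : 0 < η)
    {T : Finset (Fin N)} (hT : T.Nonempty)
    (hcov : 1 - 7 / 18 * η < ∑ j ∈ T, curvature x j) :
    Metric.hausdorffDist (convexHull ℝ (x '' (T : Set (Fin N)))) (convexHull ℝ (Set.range x)) ≤
      min (√2 * Real.pi * η ^ (1 / ((d : ℝ) - 1))) 2 * ⨆ i, ‖x i‖ := by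
  set R := ⨆ i, ‖x i‖ with hR
  have hRle : ∀ i, ‖x i‖ ≤ R := fun i =>
    le_ciSup (f := fun i => ‖x i‖) (Set.finite_range _).bddAbove i
  have hR0 : 0 ≤ R := Real.iSup_nonneg fun i => norm_nonneg _
  set B := √2 * Real.pi * η ^ (1 / ((d : ℝ) - 1)) with hB
  have hB0 : 0 < B := by positivity
  have hmin : 0 ≤ min B 2 * R := mul_nonneg (le_min hB0.le zero_le_two) hR0
  have hsub : convexHull ℝ (x '' (T : Set (Fin N))) ⊆ convexHull ℝ (Set.range x) :=
    convexHull_mono (Set.image_subset_range _ _)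
  have hball : convexHull ℝ (Set.range x) ⊆ Metric.closedBall 0 R := by
    refine convexHull_min ?_ (convex_closedBall _ _)
    rintro _ ⟨i, rfl⟩
    simpa using hRle i
  have := isProbabilityMeasure_uniformSphere (d := d) (by omega)
  refine Metric.hausdorffDist_le_of_mem_dist hmin
    (fun y hy => ⟨y, hsub hy, by simpa using hmin⟩) fun y hy => ?_
  set K := convexHull ℝ (x '' (T : Set (Fin N))) with hK
  have hKne : K.Nonempty := by
    refine convexHull_nonempty_iff.2 ?_
    exact (T.coe_nonempty.2 hT).image x
  have hKcl : IsClosed K := (T.finite_toSet.image x).isClosed_convexHull ℝ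
  obtain ⟨z, hzK, hz⟩ := exists_norm_eq_iInf_of_complete_convex hKne hKcl.isComplete
    (convex_convexHull ℝ _) y
  rw [norm_eq_iInf_iff_real_inner_le_zero (convex_convexHull ℝ _) hzK] at hz
  refine ⟨z, hzK, ?_⟩
  rw [dist_eq_norm]
  set r := ‖y - z‖ with hr
  have hr2 : r ≤ 2 * R := by
    have h1 : ‖y‖ ≤ R := by simpa using hball hy
    have h2 : ‖z‖ ≤ R := by simpa using hball (hsub hzK)
    linarith [norm_sub_le y z]
  by_contra! hlt
  have hrpos : 0 < r := hmin.trans_lt hlt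
  have hRpos : 0 < R := by linarith
  have hB2 : B < 2 := by
    by_contra! h
    rw [min_eq_right h] at hlt
    linarith
  rw [min_eq_left hB2.le] at hlt
  have hd1 : (0 : ℝ) < (d : ℝ) - 1 := by
    have : (2 : ℝ) ≤ d := by exact_mod_cast hd
    linarith
  set w := r⁻¹ • (y - z) with hw
  have hwn : ‖w‖ = 1 := by
    rw [hw, norm_smul, norm_inv, Real.norm_of_nonneg hrpos.le, ← hr, inv_mul_cancel₀ hrpos.ne']
  have hwK : ∀ p ∈ K, inner ℝ w p ≤ inner ℝ w z := by
    intro p hp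
    have h1 := hz p hp
    have h2 : inner ℝ w (p - z) ≤ 0 := by
      rw [hw, real_inner_smul_left]
      exact mul_nonpos_of_nonneg_of_nonpos (inv_nonneg.2 hrpos.le) h1
    rw [inner_sub_right] at h2
    linarith
  have hwy : inner ℝ w y = inner ℝ w z + r := by
    have : inner ℝ w (y - z) = r := by
      rw [hw, real_inner_smul_left, real_inner_self_eq_norm_sq, ← hr, sq, ← mul_assoc,
        inv_mul_cancel₀ hrpos.ne', one_mul]
    rw [inner_sub_right] at this
    linarith
  -- A linear functional on a hull is dominated by its value at some generator.
  obtain ⟨i, hi⟩ : ∃ i, inner ℝ w y ≤ inner ℝ w (x i) := by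
    by_contra! h
    have hconv : convexHull ℝ (Set.range x) ⊆ {p | inner ℝ w p < inner ℝ w y} := by
      refine convexHull_min ?_ (convex_halfSpace_lt (innerSL ℝ w).isLinear _)
      rintro _ ⟨i, rfl⟩
      exact h i
    have hyy : inner ℝ w y < inner ℝ w y := hconv hy
    exact lt_irrefl _ hyy
  set U := ⋃ j ∈ T, normalDirections x j with hU
  have hUm : MeasurableSet U :=
    Finset.measurableSet_biUnion T fun j _ => measurableSet_normalDirections x j
  -- Curvatures add up because the overlaps are null, which rests on the points being distinct.
  have hUval : (uniformSphere d).real U = ∑ j ∈ T, curvature x j := by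
    rw [hU, measureReal_def, measure_biUnion_finset₀, ENNReal.toReal_sum]
    · rfl
    · exact fun _ _ => measure_ne_top _ _
    · intro j _ k _ hjk
      exact uniformSphere_inter_normalDirections (by omega) hx hjk
    · exact fun j _ => (measurableSet_normalDirections x j).nullMeasurableSet
  have hcap := cap_le_uniformSphere hd hwn (s := r / (2 * R)) (by positivity)
    (by rw [div_le_one (by positivity)]; exact hr2) hUm.compl fun v hv => by
      rw [hU, Set.mem_compl_iff, Set.mem_iUnion₂]
      rintro ⟨k, hk, hvk⟩
      have hk1 : inner ℝ w (x k) ≤ inner ℝ w z :=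
        hwK _ (subset_convexHull ℝ _ ⟨k, hk, rfl⟩)
      have hge : r ≤ inner ℝ w (x i - x k) := by
        rw [inner_sub_right]
        linarith
      have hn : ‖x i - x k‖ ≤ 2 * R := by
        linarith [norm_sub_le (x i) (x k), hRle i, hRle k]
      have := hv (x i - x k) ?_ (hrpos.trans_le hge)
      · rw [inner_sub_right] at this
        linarith [hvk i]
      · refine le_trans ?_ hge
        rw [div_mul_eq_mul_div, div_le_iff₀ (by positivity)]
        gcongr
  rw [probReal_compl_eq_one_sub hUm, hUval] at hcap
  -- This is `B * R < r` rearranged, using `√2 * √2 = 2`; it contradicts `hcap` and `hcov`.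
  have hgt : η < (√2 * (r / (2 * R)) / Real.pi) ^ (d - 1) := by
    have hpow : η = (η ^ (1 / ((d : ℝ) - 1))) ^ (d - 1) := by
      rw [← Real.rpow_natCast, ← Real.rpow_mul hη.le, Nat.cast_sub (by omega), Nat.cast_one,
        one_div_mul_cancel hd1.ne', Real.rpow_one]
    calc η = (η ^ (1 / ((d : ℝ) - 1))) ^ (d - 1) := hpow
      _ < _ := by
        refine pow_lt_pow_left₀ ?_ (by positivity) (by omega)
        rw [lt_div_iff₀ Real.pi_pos, ← mul_div_assoc, lt_div_iff₀ (by positivity)]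
        have h2 : √2 * √2 = 2 := Real.mul_self_sqrt (by norm_num)
        have h3 : 0 < √2 := by positivity
        have h4 := mul_lt_mul_of_pos_left hlt h3
        calc _ = √2 * √2 * Real.pi * η ^ (1 / ((d : ℝ) - 1)) * R := by rw [h2]; ring
          _ = √2 * (B * R) := by rw [hB]; ring
          _ < _ := h4
  linarith

/-! ### Sorted sums and the cutoff -/

lemma card_filter_val_lt {N k : ℕ} (hk : k ≤ N) :
    (Finset.univ.filter fun j : Fin N => (j : ℕ) < k).card = k := by
  rw [← Finset.card_map Fin.valEmbedding]
  have : (Finset.univ.filter fun j : Fin N => (j : ℕ) < k).map Fin.valEmbedding =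
      Finset.range k := by
    ext m
    simp only [Finset.mem_map, Finset.mem_filter, Finset.mem_univ, true_and,
      Fin.valEmbedding_apply, Finset.mem_range]
    exact ⟨by rintro ⟨j, hj, rfl⟩; exact hj, fun h => ⟨⟨m, h.trans_le hk⟩, h, rfl⟩⟩
  rw [this, Finset.card_range]

lemma card_filter_val_lt_le (N k : ℕ) :
    (Finset.univ.filter fun j : Fin N => (j : ℕ) < k).card ≤ k := by
  rw [← Finset.card_map Fin.valEmbedding]
  refine (Finset.card_le_card (t := Finset.range k) ?_).trans_eq (Finset.card_range k)
  intro m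
  simp only [Finset.mem_map, Finset.mem_filter, Finset.mem_univ, true_and,
    Fin.valEmbedding_apply, Finset.mem_range]
  rintro ⟨j, hj, rfl⟩
  exact hj

/-- The first `k` terms of a decreasing family have the largest sum among all `k` terms. -/
lemma sum_le_sum_initial {N k : ℕ} (hk1 : 1 ≤ k) (hk : k ≤ N) {f : Fin N → ℝ} (hf : Antitone f)
    {S : Finset (Fin N)} (hS : S.card = k) :
    ∑ j ∈ S, f j ≤ ∑ j ∈ Finset.univ.filter (fun j : Fin N => (j : ℕ) < k), f j := by
  set I := Finset.univ.filter (fun j : Fin N => (j : ℕ) < k) with hI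
  have hIc : I.card = k := card_filter_val_lt hk
  -- Shifted by this threshold, the terms are nonnegative on `I` and nonpositive off it; as `S` and
  -- `I` have equal size, the shift cancels.
  set c := f ⟨k - 1, by omega⟩ with hc
  have h1 : ∑ j ∈ S, (f j - c) ≤ ∑ j ∈ S ∩ I, (f j - c) := by
    rw [← Finset.sum_inter_add_sum_sdiff S I]
    refine add_le_of_nonpos_right (Finset.sum_nonpos fun j hj => ?_)
    have hj' : ¬ (j : ℕ) < k := by simpa [hI] using (Finset.mem_sdiff.1 hj).2
    exact sub_nonpos.2 (hf (Fin.le_def.2 (by simp; omega)))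
  have h2 : ∑ j ∈ S ∩ I, (f j - c) ≤ ∑ j ∈ I, (f j - c) := by
    refine Finset.sum_le_sum_of_subset_of_nonneg Finset.inter_subset_right fun j hj _ => ?_
    have hj' : (j : ℕ) < k := by simpa [hI] using hj
    exact sub_nonneg.2 (hf (Fin.le_def.2 (by simp; omega)))
  have h3 := h1.trans h2
  simp only [Finset.sum_sub_distrib, Finset.sum_const, hS, hIc] at h3
  linarith

lemma curvature_nonneg {d N : ℕ} (x : Fin N → EuclideanSpace ℝ (Fin d)) (i : Fin N) :
    0 ≤ curvature x i := measureReal_nonneg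

/-- The largest `k` curvatures are attained on some set of `k` indices. -/
lemma exists_sum_curvature_eq {d N k : ℕ} (x : Fin N → EuclideanSpace ℝ (Fin d)) (hk : k ≤ N) :
    ∃ S : Finset (Fin N), S.card = k ∧
      ∑ j ∈ S, curvature x j = ∑ i ∈ Finset.range k, sortedCurvature x i := by
  refine ⟨(Finset.univ.filter fun j : Fin N => (j : ℕ) < k).map
    (Tuple.sort fun i => -curvature x i).toEmbedding, ?_, ?_⟩
  · rw [Finset.card_map, card_filter_val_lt hk]
  · rw [Finset.sum_map]
    refine Finset.sum_bij (fun j _ => (j : ℕ)) ?_ ?_ ?_ ?_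
    · intro j hj
      simpa using hj
    · intro a _ b _ hab
      exact Fin.ext hab
    · intro m hm
      have hm' := Finset.mem_range.1 hm
      exact ⟨⟨m, hm'.trans_le hk⟩, by simpa using hm', rfl⟩
    · intro j _
      simp [sortedCurvature]

/-- If the empirical frequencies are uniformly close to the curvatures, then the algorithm keeps few
points, and these carry almost all the curvature. -/
lemma cutoff_le_and_sum_curvature {d N M q : ℕ} {x : Fin N → EuclideanSpace ℝ (Fin d)} {η : ℝ}
    (hη : 0 < η) (hq1 : 1 ≤ q) (hqN : q ≤ N)
    (hq : 1 - η / 18 ≤ ∑ i ∈ Finset.range q, sortedCurvature x i)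
    {u : Fin M → Fin N} {σ : Equiv.Perm (Fin N)}
    (hσ : Antitone fun j => hitCount u (σ j))
    (hclose : ∀ j, |(hitCount u j : ℝ) / M - curvature x j| < η / (18 * q)) :
    cutoff d η u σ ≤ max q (d + 1) ∧
      1 - 7 / 18 * η < ∑ j ∈ (Finset.univ.filter fun j : Fin N =>
        (j : ℕ) < cutoff d η u σ).map σ.toEmbedding, curvature x j := by
  have hq0 : (0 : ℝ) < q := by exact_mod_cast hq1
  have ht : 0 < η / (18 * q) := by positivity
  have hqt : (q : ℝ) * (η / (18 * q)) = η / 18 := by field_simp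
  set A := {ℓ : ℕ | 1 - η / 3 <
    (1 / (M : ℝ)) * ∑ j ∈ Finset.univ.filter (fun j : Fin N => (j : ℕ) < ℓ),
      (hitCount u (σ j) : ℝ)} with hA
  -- The `q` largest counters sum to at least the counters of the `q` points of largest curvature,
  -- so the order of the curvatures need not be recovered. The empirical mass is at least `1 - η/18
  -- - η/18 > 1 - η/3`.
  have hqA : q ∈ A := by
    obtain ⟨S, hScard, hSsum⟩ := exists_sum_curvature_eq x hqN
    have h1 : ∑ j ∈ S, (curvature x j - η / (18 * q)) ≤ ∑ j ∈ S, (hitCount u j : ℝ) / M :=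
      Finset.sum_le_sum fun j _ => by linarith [(abs_lt.1 (hclose j)).1]
    rw [Finset.sum_sub_distrib, Finset.sum_const, hScard, nsmul_eq_mul, hqt, hSsum] at h1
    have h2 : ∑ j ∈ S, (hitCount u j : ℝ) / M =
        ∑ j ∈ S.map σ.symm.toEmbedding, (hitCount u (σ j) : ℝ) / M := by
      rw [Finset.sum_map]
      simp
    have h3 := sum_le_sum_initial hq1 hqN (f := fun j => (hitCount u (σ j) : ℝ) / M)
      (fun a b hab => div_le_div_of_nonneg_right (by exact_mod_cast hσ hab) (Nat.cast_nonneg _))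
      (S := S.map σ.symm.toEmbedding) (by rw [Finset.card_map, hScard])
    show 1 - η / 3 < _
    rw [Finset.mul_sum]
    have h4 : ∑ j ∈ Finset.univ.filter (fun j : Fin N => (j : ℕ) < q),
        1 / (M : ℝ) * (hitCount u (σ j) : ℝ) =
        ∑ j ∈ Finset.univ.filter (fun j : Fin N => (j : ℕ) < q), (hitCount u (σ j) : ℝ) / M :=
      Finset.sum_congr rfl fun j _ => by ring
    rw [h4]
    linarith
  have hle : sInf A ≤ q := Nat.sInf_le hqA
  have hcut : cutoff d η u σ = max (sInf A) (d + 1) := rfl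
  refine ⟨by rw [hcut]; exact max_le_max_right _ hle, ?_⟩
  -- The infimum is attained because `q` shows the set nonempty; it is not the default value `0` of
  -- an empty `sInf`.
  have hmem : 1 - η / 3 < (1 / (M : ℝ)) *
      ∑ j ∈ Finset.univ.filter (fun j : Fin N => (j : ℕ) < sInf A), (hitCount u (σ j) : ℝ) :=
    Nat.sInf_mem ⟨q, hqA⟩
  set I := Finset.univ.filter (fun j : Fin N => (j : ℕ) < sInf A) with hI
  have hIcard : (I.card : ℝ) ≤ q := by
    exact_mod_cast (card_filter_val_lt_le N (sInf A)).trans hle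
  have h1 : ∑ j ∈ I, ((hitCount u (σ j) : ℝ) / M - η / (18 * q)) ≤
      ∑ j ∈ I, curvature x (σ j) :=
    Finset.sum_le_sum fun j _ => by linarith [(abs_lt.1 (hclose (σ j))).2]
  rw [Finset.sum_sub_distrib, Finset.sum_const, nsmul_eq_mul] at h1
  have h2 : (1 / (M : ℝ)) * ∑ j ∈ I, (hitCount u (σ j) : ℝ) =
      ∑ j ∈ I, (hitCount u (σ j) : ℝ) / M := by
    rw [Finset.mul_sum]
    exact Finset.sum_congr rfl fun j _ => by ring
  have h3 : (I.card : ℝ) * (η / (18 * q)) ≤ η / 18 := by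
    rw [← hqt]
    gcongr
  have h4 : ∑ j ∈ I, curvature x (σ j) ≤ ∑ j ∈ (Finset.univ.filter fun j : Fin N =>
        (j : ℕ) < cutoff d η u σ).map σ.toEmbedding, curvature x j := by
    rw [Finset.sum_map]
    refine Finset.sum_le_sum_of_subset_of_nonneg ?_ fun j _ _ => curvature_nonneg x _
    intro j
    simp only [hI, Finset.mem_filter, Finset.mem_univ, true_and, hcut]
    exact fun h => h.trans_le (le_max_left _ _)
  linarith

/-! ### Concentration of the empirical frequencies -/

section Concentration

variable {d N M : ℕ} {Ω : Type*} [MeasurableSpace Ω] {P : Measure Ω}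
  {v : Fin M → Ω → Metric.sphere (0 : EuclideanSpace ℝ (Fin d)) 1}

/-- Two-sided Hoeffding bound for the number of sampled directions in a measurable set. -/
lemma measureReal_abs_frequency_sub_ge_le [IsProbabilityMeasure P] (hd : 1 ≤ d) (hM : 0 < M)
    (hv_law : ∀ i, HasLaw (v i) (uniformSphere d) P) (hv_indep : iIndepFun v P)
    {S : Set (Metric.sphere (0 : EuclideanSpace ℝ (Fin d)) 1)} (hS : MeasurableSet S)
    {t : ℝ} (ht : 0 ≤ t) :
    P.real {ω | t ≤ |(∑ i, S.indicator (fun _ => (1 : ℝ)) (v i ω)) / M -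
      (uniformSphere d).real S|} ≤ 2 * Real.exp (-(2 * M * t ^ 2)) := by
  have := isProbabilityMeasure_uniformSphere hd
  have hM0 : (0 : ℝ) < M := by exact_mod_cast hM
  set p := (uniformSphere d).real S with hp
  set g : Metric.sphere (0 : EuclideanSpace ℝ (Fin d)) 1 → ℝ :=
    S.indicator (fun _ => (1 : ℝ)) with hg
  have hgm : Measurable g := measurable_const.indicator hS
  have hint : ∀ i, ∫ ω, g (v i ω) ∂P = p := by
    intro i
    have h := (hv_law i).integral_comp hgm.aestronglyMeasurable
    have h' : ∫ ω, g (v i ω) ∂P = ∫ y, g y ∂(uniformSphere d) := h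
    rw [h', hg, integral_indicator_const _ hS, smul_eq_mul, mul_one]
  have hsub : ∀ i, HasSubgaussianMGF (fun ω => g (v i ω) - p) ((‖(1 : ℝ) - 0‖₊ / 2) ^ 2) P := by
    intro i
    rw [← hint i]
    refine hasSubgaussianMGF_of_mem_Icc (hgm.comp_aemeasurable (hv_law i).aemeasurable)
      (Filter.Eventually.of_forall fun ω => ?_)
    rw [hg]
    by_cases h : v i ω ∈ S <;> simp [h]
  have hind : iIndepFun (fun i ω => g (v i ω) - p) P :=
    hv_indep.comp (fun _ y => g y - p) fun _ => hgm.sub_const p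
  have hind' : iIndepFun (fun i ω => -(g (v i ω) - p)) P :=
    hv_indep.comp (fun _ y => -(g y - p)) fun _ => (hgm.sub_const p).neg
  -- Each centred indicator has sub-Gaussian parameter `1/4`, so the exponent is `-(M t)² / (2 * M /
  -- 4)`.
  have hexp : Real.exp (-(M * t) ^ 2 /
      (2 * ((∑ _i : Fin M, (‖(1 : ℝ) - 0‖₊ / 2) ^ 2 : NNReal) : ℝ)))
      = Real.exp (-(2 * M * t ^ 2)) := by
    congr 1
    simp
    field_simp
  have hup := HasSubgaussianMGF.measure_sum_ge_le_of_iIndepFun hind (s := Finset.univ)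
    (fun i _ => hsub i) (ε := M * t) (by positivity)
  have hlow := HasSubgaussianMGF.measure_sum_ge_le_of_iIndepFun hind' (s := Finset.univ)
    (fun i _ => (hsub i).neg) (ε := M * t) (by positivity)
  rw [hexp] at hup hlow
  calc _ ≤ P.real ({ω | M * t ≤ ∑ i, (g (v i ω) - p)} ∪ {ω | M * t ≤ ∑ i, -(g (v i ω) - p)}) := by
        refine measureReal_mono ?_
        intro ω hω
        have hω' : t ≤ |(∑ i, g (v i ω)) / M - p| := hω
        have hs : ∑ i, (g (v i ω) - p) = M * ((∑ i, g (v i ω)) / M - p) := by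
          rw [Finset.sum_sub_distrib, Finset.sum_const, Finset.card_univ, Fintype.card_fin,
            nsmul_eq_mul]
          field_simp
        rcases le_abs.1 hω' with h | h
        · left
          show M * t ≤ ∑ i, (g (v i ω) - p)
          rw [hs]
          gcongr
        · right
          show M * t ≤ ∑ i, -(g (v i ω) - p)
          rw [Finset.sum_neg_distrib, hs, ← mul_neg]
          gcongr
    _ ≤ _ := measureReal_union_le _ _
    _ ≤ _ := by linarith

/-- Almost surely no sampled direction has two maximizers. -/
lemma ae_unique_maximizer (hd : 1 ≤ d) {x : Fin N → EuclideanSpace ℝ (Fin d)}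
    (hx : Function.Injective x) (hv_law : ∀ i, HasLaw (v i) (uniformSphere d) P) :
    ∀ᵐ ω ∂P, ∀ i j k, v i ω ∈ normalDirections x j → v i ω ∈ normalDirections x k → j = k := by
  refine ae_all_iff.2 fun i => ae_all_iff.2 fun j => ae_all_iff.2 fun k => ?_
  by_cases hjk : j = k
  · exact Filter.Eventually.of_forall fun _ _ _ => hjk
  · have h := (hv_law i).measure_eq (p := fun y => y ∈ normalDirections x j ∩ normalDirections x k)
      ((measurableSet_normalDirections x j).inter (measurableSet_normalDirections x k))
    have h0 : P {ω | v i ω ∈ normalDirections x j ∩ normalDirections x k} = 0 :=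
      h.trans (uniformSphere_inter_normalDirections hd hx hjk)
    filter_upwards [measure_eq_zero_iff_ae_notMem.1 h0] with ω hω h1 h2
    exact absurd ⟨h1, h2⟩ hω

end Concentration

/-- Without ties the choice `u` is forced, so the counters depend on the directions alone and one
event serves all tie-breaking rules. -/
lemma hitCount_eq_sum_indicator {d N M : ℕ} {x : Fin N → EuclideanSpace ℝ (Fin d)}
    {y : Fin M → Metric.sphere (0 : EuclideanSpace ℝ (Fin d)) 1} {u : Fin M → Fin N}
    (hu : ∀ i, y i ∈ normalDirections x (u i))
    (huniq : ∀ i j k, y i ∈ normalDirections x j → y i ∈ normalDirections x k → j = k)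
    (j : Fin N) :
    (hitCount u j : ℝ) = ∑ i, (normalDirections x j).indicator (fun _ => (1 : ℝ)) (y i) := by
  classical
  rw [hitCount, Finset.card_filter, Nat.cast_sum]
  refine Finset.sum_congr rfl fun i _ => ?_
  by_cases h : u i = j
  · simp [h, Set.indicator_of_mem (h ▸ hu i)]
  · have : y i ∉ normalDirections x j := fun hj => h (huniq i _ _ (hu i) hj)
    simp [h, this]

end ApproxHull

/-! ### The main theorem -/

theorem mainTheorem2 {d N M : ℕ} (hd : 2 ≤ d) (hN : d < N)
    (x : Fin N → EuclideanSpace ℝ (Fin d))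
    (hx : ∀ D : Finset (Fin N), d < D.card →
      (interior (convexHull ℝ (x '' (D : Set (Fin N))))).Nonempty)
    (η δ : ℝ) (hη : 0 < η) (hδ : 0 < δ)
    (q : ℕ)
    (hq : IsLeast {j : ℕ | 1 ≤ j ∧
      1 - η / 18 ≤ ∑ i ∈ Finset.range j, ApproxHull.sortedCurvature x i} q)
    (Δ : ℝ)
    (hΔ : Δ = ApproxHull.sortedCurvature x (q - 1) - ApproxHull.sortedCurvature x q)
    (hΔ_pos : 0 < Δ)
    (hM : max (324 * (q : ℝ) ^ 2 / η ^ 2) (4 / Δ ^ 2) * Real.log (3 * (N : ℝ) / √δ) ≤ (M : ℝ))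
    {Ω : Type*} [MeasurableSpace Ω] (P : Measure Ω) [IsProbabilityMeasure P]
    (v : Fin M → Ω → Metric.sphere (0 : EuclideanSpace ℝ (Fin d)) 1)
    (hv_law : ∀ i, HasLaw (v i) (ApproxHull.uniformSphere d) P)
    (hv_indep : iIndepFun v P) :
    1 - δ ≤ P.real {ω | ∀ T : Finset (Fin N),
      ApproxHull.IsOutput x η (fun i => v i ω) T →
        T.card ≤ max q (d + 1) ∧
        Metric.hausdorffDist (convexHull ℝ (x '' (T : Set (Fin N))))
            (convexHull ℝ (Set.range x)) ≤
          min (√2 * Real.pi * η ^ (1 / ((d : ℝ) - 1))) 2 * ⨆ i, ‖x i‖} := by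
  rcases le_or_gt 1 δ with hδ1 | hδ1
  · exact le_trans (by linarith) measureReal_nonneg
  obtain ⟨⟨hq1, hqsum⟩, -⟩ := hq
  have hq0 : (0 : ℝ) < q := by exact_mod_cast hq1
  -- Beyond the `N`-th, sorted curvatures are `0` by convention, so a positive gap at `q` excludes
  -- `q > N`.
  have hqN : q ≤ N := by
    by_contra! h
    rw [hΔ, ApproxHull.sortedCurvature, ApproxHull.sortedCurvature, dif_neg (by omega),
      dif_neg (by omega)] at hΔ_pos
    simp at hΔ_pos
  have hinj := ApproxHull.injective_of_interior_convexHull_nonempty hN (by omega) hx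
  have hN0 : (1 : ℝ) ≤ N := by exact_mod_cast (by omega : 1 ≤ N)
  have hsδ : 0 < √δ := Real.sqrt_pos.2 hδ
  have hsδ1 : √δ < 1 := by rwa [Real.sqrt_lt' one_pos, one_pow]
  set l := Real.log (3 * (N : ℝ) / √δ) with hl
  have hlpos : 0 < l := by
    refine Real.log_pos ?_
    rw [one_lt_div hsδ]
    linarith
  have hMl : 324 * (q : ℝ) ^ 2 / η ^ 2 * l ≤ M :=
    (mul_le_mul_of_nonneg_right (le_max_left _ _) hlpos.le).trans hM
  have hM0 : (0 : ℝ) < M := lt_of_lt_of_le (by positivity) hMl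
  have hMnat : 0 < M := by exact_mod_cast hM0
  set t := η / (18 * q) with ht
  have ht0 : 0 < t := by positivity
  -- `324 = 18²` gives `M t² ≥ l`, and `exp (-2 l) = (√δ / (3 N))²`.
  have hexp : Real.exp (-(2 * M * t ^ 2)) ≤ δ / (9 * N ^ 2) := by
    have h1 : l ≤ M * t ^ 2 := by
      have h := mul_le_mul_of_nonneg_right hMl (sq_nonneg t)
      have h2 : 324 * (q : ℝ) ^ 2 / η ^ 2 * l * t ^ 2 = l := by
        rw [ht]
        field_simp
        norm_num
      rwa [h2] at h
    have h2 : δ / (9 * N ^ 2) = Real.exp (-(2 * l)) := by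
      rw [hl, Real.exp_neg, mul_comm 2 (Real.log _), Real.exp_mul, Real.exp_log (by positivity)]
      rw [Real.rpow_ofNat, div_pow, Real.sq_sqrt hδ.le, inv_div]
      ring
    rw [h2]
    exact Real.exp_le_exp.2 (by linarith)
  set E : Fin N → Set Ω := fun j => {ω | t ≤
    |(∑ i, (ApproxHull.normalDirections x j).indicator (fun _ => (1 : ℝ)) (v i ω)) / M -
      ApproxHull.curvature x j|} with hE
  have hEle : ∀ j, P.real (E j) ≤ 2 * (δ / (9 * N ^ 2)) := fun j =>
    (ApproxHull.measureReal_abs_frequency_sub_ge_le (by omega) hMnat hv_law hv_indep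
      (ApproxHull.measurableSet_normalDirections x j) ht0.le).trans (by linarith)
  have hEunion : P.real (⋃ j, E j) ≤ δ := by
    calc P.real (⋃ j, E j) ≤ ∑ j, P.real (E j) := measureReal_iUnion_fintype_le _
      _ ≤ ∑ _j : Fin N, 2 * (δ / (9 * N ^ 2)) := Finset.sum_le_sum fun j _ => hEle j
      _ = 2 / (9 * N) * δ := by
        rw [Finset.sum_const, Finset.card_univ, Fintype.card_fin, nsmul_eq_mul]
        field_simp
      _ ≤ 1 * δ := by
        gcongr
        rw [div_le_one (by positivity)]
        linarith
      _ = δ := one_mul δ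
  set Z := {ω | ¬ ∀ i j k, v i ω ∈ ApproxHull.normalDirections x j →
    v i ω ∈ ApproxHull.normalDirections x k → j = k} with hZ
  have hZ0 : P.real Z = 0 := by
    rw [measureReal_def, ae_iff.1 (ApproxHull.ae_unique_maximizer (by omega) hinj hv_law)]
    rfl
  set G := {ω | ∀ T : Finset (Fin N),
      ApproxHull.IsOutput x η (fun i => v i ω) T →
        T.card ≤ max q (d + 1) ∧
        Metric.hausdorffDist (convexHull ℝ (x '' (T : Set (Fin N))))
            (convexHull ℝ (Set.range x)) ≤
          min (√2 * Real.pi * η ^ (1 / ((d : ℝ) - 1))) 2 * ⨆ i, ‖x i‖} with hG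
  -- Covering the whole space and using subadditivity avoids having to know that `G` is measurable.
  have hcover : Set.univ ⊆ G ∪ (Z ∪ ⋃ j, E j) := by
    intro ω _
    by_contra hω
    simp only [Set.mem_union, not_or, Set.mem_iUnion, not_exists] at hω
    obtain ⟨hωG, hωZ, hωE⟩ := hω
    refine hωG ?_
    have huniq := not_not.1 hωZ
    rintro T ⟨u, σ, hu, hσ, rfl⟩
    have hclose : ∀ j, |(ApproxHull.hitCount u j : ℝ) / M - ApproxHull.curvature x j| < t := by
      intro j
      rw [ApproxHull.hitCount_eq_sum_indicator hu huniq j]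
      exact not_le.1 (hωE j)
    obtain ⟨hcut, hsum⟩ :=
      ApproxHull.cutoff_le_and_sum_curvature (d := d) hη hq1 hqN hqsum hσ hclose
    refine ⟨?_, ApproxHull.hausdorffDist_convexHull_le hd hinj hη ?_ hsum⟩
    · rw [Finset.card_map]
      exact (ApproxHull.card_filter_val_lt_le _ _).trans hcut
    -- The cutoff is at least `d + 1`, so index `0` is always kept.
    · refine Finset.Nonempty.map ⟨⟨0, by omega⟩, ?_⟩
      simp [ApproxHull.cutoff]
  have h1 : (1 : ℝ) ≤ P.real G + (P.real Z + P.real (⋃ j, E j)) := by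
    calc (1 : ℝ) = P.real Set.univ := probReal_univ.symm
      _ ≤ P.real (G ∪ (Z ∪ ⋃ j, E j)) := measureReal_mono hcover
      _ ≤ P.real G + P.real (Z ∪ ⋃ j, E j) := measureReal_union_le _ _
      _ ≤ _ := by gcongr; exact measureReal_union_le _ _
  linarith
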